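/- Write $[x,y]=x^{-1}y^{-1}xy$ and $x^y=y^{-1}xy$, and let $\Gamma=\langle a,b\;;\;a=[a,a^b]\rangle$. For a group $G$, let $D(G)=[G,G]$ be its derived group and let $(D^n(G))_{n\ge 0}$ be its derived series, $D^0(G)=G$ and $D^{n+1}(G)=D(D^n(G))$. Let $P\mathcal S(G)$ be the true prosoluble completion of $G$, that is, the inverse limit of the quotients $G/N$ over all normal subgroups $N$ of $G$ such that $G/N$ is soluble (finite or not), and let $P\mathcal F(G)$ be the profinite completion of $G$, the inverse limit of the quotients of $G$ by its normal subgroups of finite index. Both are topological groups, with the inverse limit topology for discrete quotients. Then: 1. the true prosoluble kernel $\operatorname{Ker}(\Gamma\to P\mathcal S(\Gamma))=\bigcap_{n\ge 0}D^n(\Gamma)$ is equal to $D(\Gamma)$, and the profinite kernel $\operatorname{Ker}(\Gamma\to P\mathcal F(\Gamma))$ is also equal to $D(\Gamma)$; 2. $D(\Gamma)$ is the normal closure of $a$ in $\Gamma$, it is perfect, and it is not reduced to one element; 3. $\Gamma/D(\Gamma)\cong\mathbf Z$, and there are isomorphisms of topological groups $P\mathcal S(\Gamma)\cong\mathbf Z$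 (with $\mathbf Z$ discrete) and $P\mathcal F(\Gamma)\cong\prod_p\mathbf Z_p$ (the product over all primes $p$ of the additive groups of $p$-adic integers); moreover $P\mathcal S(\Gamma)$ and $P\mathcal F(\Gamma)$ are not isomorphic, even as abstract groups. -/

import Mathlib

/-! ### The true prosoluble completion of a group -/

/-- The set `𝒮` of normal subgroups of `Γ` with soluble quotient. -/
def SolubleQuotientSubgroup (Γ : Type*) [Group Γ] : Type _ :=
  {N : Subgroup Γ // ∃ _ : N.Normal, Group.IsSolvable (Γ ⧸ N)}

instance SolubleQuotientSubgroup.normal {Γ : Type*} [Group Γ]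
    (N : SolubleQuotientSubgroup Γ) : N.1.Normal :=
  N.2.1

/-- The inverse limit of the soluble quotients `Γ ⧸ N`, as a subgroup of their product: the families
compatible with all projections `Γ ⧸ N → Γ ⧸ M` for `N ≤ M`. -/
def trueProsolubleLimit (Γ : Type*) [Group Γ] :
    Subgroup (∀ N : SolubleQuotientSubgroup Γ, Γ ⧸ N.1) where
  carrier := {x | ∀ (N M : SolubleQuotientSubgroup Γ) (h : N.1 ≤ M.1),
    QuotientGroup.map N.1 M.1 (MonoidHom.id Γ) h (x N) = x M}
  one_mem' := fun _ _ _ => map_one _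
  mul_mem' := fun {x y} hx hy N M h => by
    simp only [Pi.mul_apply, map_mul, hx N M h, hy N M h]
  inv_mem' := fun {x} hx N M h => by
    simp only [Pi.inv_apply, map_inv, hx N M h]

/-- The true prosoluble completion of `Γ`, the inverse limit of all soluble quotients of `Γ`. -/
def TrueProsolubleCompletion (Γ : Type*) [Group Γ] : Type _ :=
  ↥(trueProsolubleLimit Γ)

namespace TrueProsolubleCompletion

instance group (Γ : Type*) [Group Γ] : Group (TrueProsolubleCompletion Γ) :=
  inferInstanceAs (Group ↥(trueProsolubleLimit Γ))

/-- The topology of the inverse limit: induced by the product topology, where every soluble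
quotient `Γ ⧸ N` is discrete. -/
instance topologicalSpace (Γ : Type*) [Group Γ] :
    TopologicalSpace (TrueProsolubleCompletion Γ) :=
  TopologicalSpace.induced
    (fun x : ↥(trueProsolubleLimit Γ) => (x : ∀ N : SolubleQuotientSubgroup Γ, Γ ⧸ N.1))
    (@Pi.topologicalSpace _ _ fun _ => ⊥)

instance isTopologicalGroup (Γ : Type*) [Group Γ] :
    IsTopologicalGroup (TrueProsolubleCompletion Γ) := by
  let _ : ∀ N : SolubleQuotientSubgroup Γ, TopologicalSpace (Γ ⧸ N.1) := fun _ => ⊥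
  have _ : ∀ N : SolubleQuotientSubgroup Γ, DiscreteTopology (Γ ⧸ N.1) := fun _ => ⟨rfl⟩
  exact inferInstanceAs (IsTopologicalGroup ↥(trueProsolubleLimit Γ))

/-- The canonical homomorphism from `Γ` to its true prosoluble completion. -/
def of (Γ : Type*) [Group Γ] : Γ →* TrueProsolubleCompletion Γ where
  toFun g := ⟨fun _ => (g : Γ ⧸ _), fun _ _ _ => rfl⟩
  map_one' := rfl
  map_mul' _ _ := rfl

end TrueProsolubleCompletion

/-! ### Baumslag's group -/

/-- The convention `[x, y] = x⁻¹ y⁻¹ x y` for commutators. -/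
def rightCommutator {G : Type*} [Group G] (x y : G) : G :=
  x⁻¹ * y⁻¹ * x * y

/-- The convention `x ^ y = y⁻¹ x y` for conjugates. -/
def rightConj {G : Type*} [Group G] (x y : G) : G :=
  y⁻¹ * x * y

/-- The relator `a [a, a ^ b]⁻¹` in the free group on `a = of 0` and `b = of 1`. -/
def baumslagRelator : FreeGroup (Fin 2) :=
  FreeGroup.of 0 *
    (rightCommutator (FreeGroup.of 0) (rightConj (FreeGroup.of 0) (FreeGroup.of 1)))⁻¹

/-- The one-relator group `⟨a, b ; a = [a, a ^ b]⟩`. -/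
abbrev BaumslagGroup : Type :=
  PresentedGroup ({baumslagRelator} : Set (FreeGroup (Fin 2)))

/-- The generator `a` of `⟨a, b ; a = [a, a ^ b]⟩`. -/
def BaumslagGroup.a : BaumslagGroup :=
  PresentedGroup.of 0

instance primesFact (p : Nat.Primes) : Fact (p : ℕ).Prime :=
  ⟨p.2⟩

/-! Let K be the normal closure of a. The relation writes a as a commutator of two elements of K, so
K = [K, K]; and Γ/K is infinite cyclic, generated by b. Hence K = D(Γ), and the derived series is
constant from there on. So D(Γ) is the least normal subgroup with soluble quotient, and the true
prosoluble completion is just Γ/D(Γ) ≅ ℤ.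

The relation also says that z = a^b conjugates a to a². In a finite group z has the same order n as
a, so a = a^(2^n) and n divides 2^n - 1, which forces n = 1. Finite quotients thus kill a, and the
profinite completion is that of ℤ, namely the product of the ℤ_p; it is not cyclic, hence not
isomorphic to ℤ.

Finally a ≠ 1: two affine maps of ℚ satisfy x = [x, y] with x, y of infinite order, and an HNN
extension makes y a conjugate of x. -/

namespace BaumslagGroup

/-- The generator `b` of `⟨a, b ; a = [a, a ^ b]⟩`. -/
def b : BaumslagGroup :=
  PresentedGroup.of 1

theorem a_eq_rightCommutator : a = rightCommutator a (rightConj a b) := by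
  have h : PresentedGroup.mk {baumslagRelator} baumslagRelator = 1 :=
    PresentedGroup.one_of_mem rfl
  exact mul_inv_eq_one.1 h

/-- The homomorphism to `H` given by the images of the two generators. -/
def lift {H : Type*} [Group H] (x y : H) (h : x = rightCommutator x (rightConj x y)) :
    BaumslagGroup →* H :=
  PresentedGroup.toGroup (f := ![x, y]) (by
    rintro r rfl
    rw [baumslagRelator, map_mul, map_inv, mul_inv_eq_one]
    simpa [rightCommutator, rightConj] using h)

section lift

variable {H : Type*} [Group H] {x y : H} (h : x = rightCommutator x (rightConj x y))

@[simp]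
theorem lift_a : lift x y h a = x := by
  simp [lift, a]

@[simp]
theorem lift_b : lift x y h b = y := by
  simp [lift, b]

end lift

theorem hom_ext {H : Type*} [Group H] {f g : BaumslagGroup →* H} (ha : f a = g a)
    (hb : f b = g b) : f = g :=
  PresentedGroup.ext fun i => by
    fin_cases i
    exacts [ha, hb]

/-- The homomorphism to `ℤ` killing `a` and sending `b` to `1`. -/
def exponent : BaumslagGroup →* Multiplicative ℤ :=
  lift 1 (Multiplicative.ofAdd 1) (by simp [rightCommutator, rightConj])

@[simp]
theorem exponent_a : exponent a = 1 :=
  lift_a _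

@[simp]
theorem exponent_b : exponent b = Multiplicative.ofAdd 1 :=
  lift_b _

theorem exponent_b_zpow (k : ℤ) : exponent (b ^ k) = Multiplicative.ofAdd k := by
  rw [map_zpow, exponent_b, ← ofAdd_zsmul, smul_eq_mul, mul_one]

theorem exponent_surjective : Function.Surjective exponent := fun k =>
  ⟨b ^ k.toAdd, exponent_b_zpow _⟩

/-- Every homomorphism killing `a` factors through `exponent`. -/
theorem map_eq_zpow {H : Type*} [Group H] (f : BaumslagGroup →* H) (hf : f a = 1)
    (g : BaumslagGroup) : f g = f b ^ (exponent g).toAdd := by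
  have h : f = (zpowersHom H (f b)).comp exponent := hom_ext (by simp [hf]) (by simp)
  conv_lhs => rw [h]
  simp

/-! ### Abelianization and derived series -/

theorem ker_exponent : exponent.ker = Subgroup.normalClosure {a} := by
  refine le_antisymm (fun g hg => ?_) (Subgroup.normalClosure_le_normal (by simp))
  rw [← QuotientGroup.eq_one_iff, ← QuotientGroup.mk'_apply,
    map_eq_zpow (QuotientGroup.mk' (Subgroup.normalClosure {a})) ?_ g, MonoidHom.mem_ker.1 hg]
  · simp
  · exact (QuotientGroup.eq_one_iff _).2 (Subgroup.subset_normalClosure rfl)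

theorem normalClosure_le_commutator_normalClosure :
    Subgroup.normalClosure {a} ≤
      ⁅Subgroup.normalClosure {a}, Subgroup.normalClosure {a}⁆ := by
  have h : a ∈ Subgroup.normalClosure {a} := Subgroup.subset_normalClosure rfl
  have h' := Subgroup.normalClosure_normal.conj_mem _ h b⁻¹
  refine Subgroup.normalClosure_le_normal (Set.singleton_subset_iff.2 ?_)
  have h₁ := Subgroup.commutator_mem_commutator (inv_mem h) (inv_mem h')
  suffices h₂ : rightCommutator a (rightConj a b) ∈
      ⁅Subgroup.normalClosure {a}, Subgroup.normalClosure {a}⁆ by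
    rwa [← a_eq_rightCommutator] at h₂
  simpa [commutatorElement_def, rightCommutator, rightConj, mul_assoc] using h₁

theorem commutator_eq_normalClosure :
    commutator BaumslagGroup = Subgroup.normalClosure {a} := by
  refine le_antisymm ?_ (normalClosure_le_commutator_normalClosure.trans
    (Subgroup.commutator_mono le_top le_top))
  rw [← ker_exponent]
  exact Abelianization.commutator_subset_ker exponent

theorem ker_exponent_eq_commutator : exponent.ker = commutator BaumslagGroup :=
  ker_exponent.trans commutator_eq_normalClosure.symm

theorem commutator_commutator :
    ⁅commutator BaumslagGroup, commutator BaumslagGroup⁆ = commutator BaumslagGroup := by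
  refine le_antisymm (Subgroup.commutator_le_left _ _) ?_
  rw [commutator_eq_normalClosure]
  exact normalClosure_le_commutator_normalClosure

theorem isPerfect_commutator : Group.IsPerfect (commutator BaumslagGroup) := by
  rw [Group.isPerfect_def]
  apply Subgroup.map_injective (commutator BaumslagGroup).subtype_injective
  rw [commutator_def ↥(commutator BaumslagGroup), Subgroup.map_commutator,
    ← MonoidHom.range_eq_map, Subgroup.range_subtype, commutator_commutator]

theorem derivedSeries_succ (n : ℕ) :
    derivedSeries BaumslagGroup (n + 1) = commutator BaumslagGroup := by
  induction n with
  | zero => exact derivedSeries_one _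
  | succ n ih => rw [_root_.derivedSeries_succ, ih, commutator_commutator]

theorem commutator_le_derivedSeries (n : ℕ) :
    commutator BaumslagGroup ≤ derivedSeries BaumslagGroup n := by
  cases n with
  | zero => exact le_top
  | succ n => exact (derivedSeries_succ n).ge

theorem iInf_derivedSeries :
    ⨅ n : ℕ, derivedSeries BaumslagGroup n = commutator BaumslagGroup :=
  le_antisymm ((iInf_le _ 1).trans (derivedSeries_succ 0).le)
    (le_iInf commutator_le_derivedSeries)

/-- The isomorphism of the abelianization with `ℤ` induced by `exponent`. -/
noncomputable def quotientCommutatorEquiv :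
    BaumslagGroup ⧸ commutator BaumslagGroup ≃* Multiplicative ℤ :=
  (QuotientGroup.quotientMulEquivOfEq ker_exponent_eq_commutator.symm).trans
    (QuotientGroup.quotientKerEquivOfSurjective exponent exponent_surjective)

@[simp]
theorem quotientCommutatorEquiv_mk (g : BaumslagGroup) :
    quotientCommutatorEquiv (g : BaumslagGroup ⧸ commutator BaumslagGroup) = exponent g :=
  rfl

/-! ### Nontriviality of `a` -/

/-- Two elements of infinite order become conjugate in an HNN extension. -/
theorem exists_injective_hom_conj {G : Type} [Group G] (x y : G)
    (hx : Function.Injective fun n : ℤ => x ^ n) (hy : Function.Injective fun n : ℤ => y ^ n) :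
    ∃ (H : Type) (_ : Group H) (f : G →* H) (t : H),
      Function.Injective f ∧ t * f x * t⁻¹ = f y := by
  let e (z : G) (hz : Function.Injective fun n : ℤ => z ^ n) :
      Multiplicative ℤ ≃* (zpowersHom G z).range :=
    MonoidHom.ofInjective fun m n h => hz h
  let φ := (e x hx).symm.trans (e y hy)
  have hφ : φ (e x hx (Multiplicative.ofAdd 1)) = e y hy (Multiplicative.ofAdd 1) := by
    simp [φ]
  have h := HNNExtension.equiv_eq_conj (φ := φ) (e x hx (Multiplicative.ofAdd 1))
  rw [hφ] at h
  have he (z : G) (hz : Function.Injective fun n : ℤ => z ^ n) :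
      (e z hz (Multiplicative.ofAdd 1) : G) = z :=
    (MonoidHom.ofInjective_apply _).trans (by simp)
  rw [he, he] at h
  exact ⟨_, _, HNNExtension.of, HNNExtension.t, HNNExtension.of_injective φ, h.symm⟩

theorem a_ne_one : a ≠ 1 := by
  let x : Equiv.Perm ℚ := Equiv.addRight 1
  -- Conjugating the translation by 1 with halving gives y⁻¹xy = x², that is x = [x, y].
  let y : Equiv.Perm ℚ := Equiv.mulRight₀ (1 / 2) (by norm_num)
  have hx (n : ℕ) : (x ^ n) 0 = n := by simp [x]
  have hy (n : ℕ) : (y ^ n) 1 = (1 / 2) ^ n := by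
    induction n with
    | zero => simp
    | succ n ih => rw [pow_succ', Equiv.Perm.mul_apply, ih, pow_succ]; rfl
  obtain ⟨H, _, f, t, hf, ht⟩ := exists_injective_hom_conj x y
    (injective_zpow_iff_not_isOfFinOrder.2 fun h => by
      obtain ⟨n, hn, h⟩ := isOfFinOrder_iff_pow_eq_one.1 h
      have := hx n
      rw [h, Equiv.Perm.one_apply, eq_comm, Nat.cast_eq_zero] at this
      exact hn.ne' this)
    (injective_zpow_iff_not_isOfFinOrder.2 fun h => by
      obtain ⟨n, hn, h⟩ := isOfFinOrder_iff_pow_eq_one.1 h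
      have := hy n
      rw [h, Equiv.Perm.one_apply] at this
      exact (pow_lt_one₀ (by norm_num) (by norm_num) hn.ne').ne' this)
  have hxy : x = rightCommutator x y := by
    rw [rightCommutator, ← mul_left_inj y⁻¹, ← mul_right_inj (y * x)]
    ext q
    simp [x, y]
    ring
  -- The stable letter satisfies t x t⁻¹ = y, so t⁻¹ plays the role of b.
  have h : f x = rightCommutator (f x) (rightConj (f x) t⁻¹) := by
    rw [rightConj, inv_inv, ht]
    simpa only [rightCommutator, map_mul, map_inv] using congrArg f hxy
  intro ha
  have h₁ := congrArg (lift _ _ h) ha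
  rw [lift_a, map_one, ← map_one f] at h₁
  have h₂ := congrArg (fun p : Equiv.Perm ℚ => p 0) (hf h₁)
  simp [x] at h₂

theorem commutator_ne_bot : commutator BaumslagGroup ≠ ⊥ := by
  rw [commutator_eq_normalClosure]
  intro h
  have ha : a ∈ Subgroup.normalClosure {a} := Subgroup.subset_normalClosure rfl
  rw [h] at ha
  exact a_ne_one (Subgroup.mem_bot.1 ha)

/-! ### Finite quotients -/

/-- If p is the least prime factor of n, the order of 2 modulo p divides both n and p - 1. These are
coprime by minimality of p, so 2 = 1 modulo p, which is absurd. -/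
theorem _root_.Nat.eq_one_of_dvd_two_pow_self_sub_one {n : ℕ} (hn : n ≠ 0) (h : n ∣ 2 ^ n - 1) :
    n = 1 := by
  by_contra h1
  have hp := Nat.minFac_prime h1
  have : Fact n.minFac.Prime := ⟨hp⟩
  have h2 : (2 : ZMod n.minFac) ^ n = 1 := by
    have := (ZMod.natCast_eq_zero_iff _ _).2 ((Nat.minFac_dvd n).trans h)
    rwa [Nat.cast_sub Nat.one_le_two_pow, sub_eq_zero, Nat.cast_pow, Nat.cast_one] at this
  have h0 : (2 : ZMod n.minFac) ≠ 0 := by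
    intro h0
    rw [h0, zero_pow hn] at h2
    exact zero_ne_one h2
  have hc : n.gcd (n.minFac - 1) = 1 := by
    refine Nat.coprime_of_lt_minFac (by have := hp.two_le; omega) ?_
    have := hp.two_le
    omega
  have h3 := pow_gcd_eq_one.2 ⟨h2, ZMod.pow_card_sub_one_eq_one h0⟩
  rw [hc, pow_one, ← one_add_one_eq_two, add_eq_left] at h3
  exact one_ne_zero h3

/-- In a finite group, an element conjugated to its square by a conjugate of itself is trivial. -/
theorem eq_one_of_eq_rightCommutator {G : Type*} [Group G] [Finite G] {x y : G}
    (h : x = rightCommutator x (rightConj x y)) : x = 1 := by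
  set z := rightConj x y with hz
  have hsq : z⁻¹ * x * z = x ^ 2 := by
    have h' : x * x = x * rightCommutator x z := congrArg (x * ·) h
    rw [pow_two, h', rightCommutator]
    group
  have hpow (n : ℕ) : (z ^ n)⁻¹ * x * z ^ n = x ^ 2 ^ n := by
    induction n with
    | zero => simp
    | succ n ih =>
      have h' := conj_pow (i := 2 ^ n) (a := z⁻¹) (b := x)
      rw [inv_inv, hsq, ← pow_mul, ← pow_succ'] at h'
      rw [h', ← ih, pow_succ]
      group
  have hord : z ^ orderOf x = 1 := by
    have := conj_pow (i := orderOf x) (a := y⁻¹) (b := x)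
    rw [inv_inv] at this
    rw [hz, rightConj, this, pow_orderOf_eq_one]
    group
  have h₁ := hpow (orderOf x)
  rw [hord, inv_one, one_mul, mul_one] at h₁
  rw [← orderOf_eq_one_iff]
  refine Nat.eq_one_of_dvd_two_pow_self_sub_one (orderOf_pos x).ne' ?_
  rw [orderOf_dvd_iff_pow_eq_one, pow_sub _ Nat.one_le_two_pow, ← h₁, pow_one, mul_inv_cancel]

theorem map_a_of_finite {G : Type*} [Group G] [Finite G] (f : BaumslagGroup →* G) : f a = 1 :=
  eq_one_of_eq_rightCommutator (y := f b) (by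
    conv_lhs => rw [a_eq_rightCommutator]
    simp [rightCommutator, rightConj])

/-! ### The true prosoluble completion -/

theorem commutator_le_of_isSolvable (N : SolubleQuotientSubgroup BaumslagGroup) :
    commutator BaumslagGroup ≤ N.1 := by
  obtain ⟨n, hn⟩ := (Group.isSolvable_def _).1 N.2.2
  refine (commutator_le_derivedSeries n).trans ?_
  rw [← QuotientGroup.ker_mk' N.1, ← Subgroup.map_eq_bot_iff]
  exact le_bot_iff.1 ((map_derivedSeries_le_derivedSeries _ n).trans hn.le)

/-- The commutator subgroup, as a member of the family of subgroups with soluble quotient. -/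
def commutatorSoluble : SolubleQuotientSubgroup BaumslagGroup :=
  ⟨commutator BaumslagGroup, inferInstance,
    inferInstanceAs (Group.IsSolvable (Abelianization BaumslagGroup))⟩

theorem ker_of_eq_commutator :
    (TrueProsolubleCompletion.of BaumslagGroup).ker = commutator BaumslagGroup := by
  ext g
  rw [MonoidHom.mem_ker]
  refine ⟨fun h => ?_, fun h => Subtype.ext (funext fun N => ?_)⟩
  · exact (QuotientGroup.eq_one_iff g).1 (congrFun (congrArg Subtype.val h) commutatorSoluble)
  · exact (QuotientGroup.eq_one_iff g).2 (commutator_le_of_isSolvable N h)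

/-- The homomorphism from the true prosoluble completion to `ℤ` extending `exponent`. -/
noncomputable def prosolubleExponent : TrueProsolubleCompletion BaumslagGroup →* Multiplicative ℤ :=
  quotientCommutatorEquiv.toMonoidHom.comp
    ((Pi.evalMonoidHom _ commutatorSoluble).comp (trueProsolubleLimit BaumslagGroup).subtype)

theorem prosolubleExponent_of (g : BaumslagGroup) :
    prosolubleExponent (TrueProsolubleCompletion.of _ g) = exponent g :=
  rfl

/-- The coordinate at D(Γ), the least index, determines all others by compatibility. -/
theorem prosolubleExponent_bijective : Function.Bijective prosolubleExponent := by
  refine ⟨(injective_iff_map_eq_one _).2 fun x hx => ?_, fun k => ?_⟩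
  · have h : x.1 commutatorSoluble = 1 := quotientCommutatorEquiv.map_eq_one_iff.1 hx
    refine Subtype.ext (funext fun N => ?_)
    rw [← x.2 commutatorSoluble N (commutator_le_of_isSolvable N), h, map_one]
    rfl
  · obtain ⟨g, rfl⟩ := exponent_surjective k
    exact ⟨_, prosolubleExponent_of g⟩

theorem continuous_prosolubleExponent : Continuous prosolubleExponent := by
  let _ : ∀ N : SolubleQuotientSubgroup BaumslagGroup, TopologicalSpace (BaumslagGroup ⧸ N.1) :=
    fun _ => ⊥
  have _ : ∀ N : SolubleQuotientSubgroup BaumslagGroup, DiscreteTopology (BaumslagGroup ⧸ N.1) :=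
    fun _ => ⟨rfl⟩
  have : DiscreteTopology (BaumslagGroup ⧸ commutatorSoluble.1) := ⟨rfl⟩
  exact (continuous_of_discreteTopology (α := BaumslagGroup ⧸ commutatorSoluble.1)
    (f := quotientCommutatorEquiv)).comp
    ((continuous_apply commutatorSoluble).comp continuous_induced_dom)

/-- The true prosoluble completion of Baumslag's group is `ℤ`, with the discrete topology. -/
noncomputable def prosolubleEquiv :
    TrueProsolubleCompletion BaumslagGroup ≃ₜ* Multiplicative ℤ where
  toMulEquiv := MulEquiv.ofBijective prosolubleExponent prosolubleExponent_bijective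
  continuous_toFun := continuous_prosolubleExponent
  continuous_invFun := continuous_of_discreteTopology

open ProfiniteGrp.ProfiniteCompletion

/-! ### The group `∏ p, ℤ_[p]` -/

/-- The diagonal homomorphism from `ℤ` to the product of the groups of `p`-adic integers. -/
noncomputable def diagonal : Multiplicative ℤ →* ∀ p : Nat.Primes, Multiplicative ℤ_[p] :=
  MonoidHom.mk' (fun k p => Multiplicative.ofAdd (k.toAdd : ℤ_[p])) fun k l => by
    ext p
    simp

/-- A basic open set constrains finitely many coordinates, each through a congruence modulo a prime
power; the Chinese remainder theorem gives an integer meeting them all. -/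
theorem denseRange_diagonal : DenseRange diagonal := by
  intro x
  rw [mem_closure_iff]
  intro U hU hx
  obtain ⟨I, u, hu, hIU⟩ := isOpen_pi_iff.1 hU x hx
  have h (p : Nat.Primes) : ∃ n : ℕ, p ∈ I → ∀ y : ℤ_[p],
      y - (x p).toAdd ∈ Ideal.span {((p : ℕ) : ℤ_[p]) ^ n} → Multiplicative.ofAdd y ∈ u p := by
    by_cases hp : p ∈ I
    · have h1 : IsOpen (Multiplicative.ofAdd ⁻¹' u p : Set ℤ_[p]) :=
        (hu p hp).1.preimage continuous_ofAdd
      obtain ⟨ε, hε, h2⟩ := Metric.isOpen_iff.1 h1 (x p).toAdd (hu p hp).2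
      obtain ⟨n, hn⟩ := PadicInt.exists_pow_neg_lt p hε
      refine ⟨n, fun _ y hy => h2 (mem_ball_iff_norm.2 ?_)⟩
      exact ((PadicInt.norm_le_pow_iff_mem_span_pow _ _).2 hy).trans_lt hn
    · exact ⟨0, fun h => (hp h).elim⟩
  choose n hn using h
  obtain ⟨k, hk⟩ := Nat.chineseRemainderOfFinset (fun p : Nat.Primes => (x p).toAdd.appr (n p))
    (fun p => (p : ℕ) ^ n p) I (fun p _ => pow_ne_zero _ p.2.ne_zero) fun p _ q _ hpq =>
      Nat.coprime_pow_primes _ _ p.2 q.2 fun h => hpq (Subtype.ext h)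
  refine ⟨diagonal (Multiplicative.ofAdd (k : ℤ)), hIU fun p hp => ?_, Set.mem_range_self _⟩
  refine hn p hp (k : ℤ) ?_
  have h1 := PadicInt.appr_spec (n p) (x p).toAdd
  have h2 : ((k : ℤ) : ℤ_[p]) - (x p).toAdd.appr (n p) ∈ Ideal.span {((p : ℕ) : ℤ_[p]) ^ n p} := by
    rw [Ideal.mem_span_singleton]
    obtain ⟨c, hc⟩ := (Nat.modEq_iff_dvd.1 (hk p hp).symm)
    refine ⟨c, ?_⟩
    have := congrArg (Int.cast : ℤ → ℤ_[p]) hc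
    push_cast at this ⊢
    exact this
  have h3 := sub_mem h2 h1
  rwa [sub_sub_sub_cancel_right] at h3

/-- The product of the groups of `p`-adic integers, as a profinite group. -/
noncomputable def padicProd : ProfiniteGrp.{0} :=
  ProfiniteGrp.of (∀ p : Nat.Primes, Multiplicative ℤ_[p])

/-- If a power of a generator g is 1 at p and 0 elsewhere, its exponent is nonzero, so g vanishes
away from p because ℤ_q is torsion-free. With p = 2, g is 0 at 3, so no power of g is 1 there. -/
theorem not_isCyclic_padicProd : ¬ IsCyclic (∀ p : Nat.Primes, Multiplicative ℤ_[p]) := by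
  rintro ⟨g, hg⟩
  let p₂ : Nat.Primes := ⟨2, Nat.prime_two⟩
  let p₃ : Nat.Primes := ⟨3, Nat.prime_three⟩
  have h23 : p₃ ≠ p₂ := fun h => by simpa [p₂, p₃] using congrArg Subtype.val h
  have key (p q : Nat.Primes) (hpq : q ≠ p) : (g q).toAdd = 0 := by
    obtain ⟨m, hm⟩ := Subgroup.mem_zpowers_iff.1
      (hg (Pi.mulSingle p (Multiplicative.ofAdd 1)))
    have hmp := congrArg Multiplicative.toAdd (congrFun hm p)
    have hmq := congrArg Multiplicative.toAdd (congrFun hm q)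
    rw [Pi.mulSingle_eq_same] at hmp
    rw [Pi.mulSingle_eq_of_ne hpq] at hmq
    have hm0 : m ≠ 0 := by
      rintro rfl
      simp at hmp
    simpa [hm0] using hmq
  obtain ⟨m, hm⟩ := Subgroup.mem_zpowers_iff.1 (hg (Pi.mulSingle p₃ (Multiplicative.ofAdd 1)))
  have hm3 := congrArg Multiplicative.toAdd (congrFun hm p₃)
  rw [Pi.mulSingle_eq_same] at hm3
  simp [key p₂ p₃ h23] at hm3

/-! ### The profinite completion -/

theorem _root_.ProfiniteGrp.ProfiniteCompletion.lift_etaFn {G : GrpCat} {P : ProfiniteGrp}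
    (f : G ⟶ GrpCat.of P) (g : G) :
    (ProfiniteGrp.ProfiniteCompletion.lift f).hom (etaFn G g) = f.hom g :=
  CategoryTheory.ConcreteCategory.congr_hom (lift_eta f) g

/-- The continuous homomorphism from the profinite completion to `∏ p, ℤ_[p]` extending
`exponent`. -/
noncomputable def profiniteExponent : completion (GrpCat.of BaumslagGroup) ⟶ padicProd :=
  ProfiniteGrp.ProfiniteCompletion.lift
    (GrpCat.ofHom (diagonal.comp exponent) : GrpCat.of BaumslagGroup ⟶ GrpCat.of padicProd)

theorem profiniteExponent_etaFn (g : BaumslagGroup) :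
    profiniteExponent.hom (etaFn (GrpCat.of BaumslagGroup) g) = diagonal (exponent g) :=
  ProfiniteGrp.ProfiniteCompletion.lift_etaFn (G := GrpCat.of BaumslagGroup) (P := padicProd)
    (GrpCat.ofHom (diagonal.comp exponent)) g

theorem profiniteExponent_surjective : Function.Surjective profiniteExponent.hom := by
  have hc : IsClosed (Set.range profiniteExponent.hom) :=
    (isCompact_range profiniteExponent.hom.continuous_toFun).isClosed
  have hd : DenseRange profiniteExponent.hom :=
    denseRange_diagonal.mono (Set.range_subset_iff.2 fun k => by
      obtain ⟨g, rfl⟩ := exponent_surjective k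
      exact ⟨_, profiniteExponent_etaFn g⟩)
  rw [← Set.range_eq_univ, ← hc.closure_eq]
  exact hd.closure_range

theorem mem_of_index_dvd (N : Subgroup BaumslagGroup) [N.Normal] [N.FiniteIndex]
    {g : BaumslagGroup} (hg : (N.index : ℤ) ∣ (exponent g).toAdd) : g ∈ N := by
  rw [← QuotientGroup.eq_one_iff, ← QuotientGroup.mk'_apply,
    map_eq_zpow (QuotientGroup.mk' N) (map_a_of_finite _) g]
  obtain ⟨c, hc⟩ := hg
  rw [hc, zpow_mul, zpow_natCast, Subgroup.index, pow_card_eq_one', one_zpow]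

/-- For x in the kernel and N of finite index, approximate x by some g in Γ with the same coordinate
at N and exponent divisible by the index of N. Then g lies in N, so x is trivial at N. -/
theorem profiniteExponent_injective : Function.Injective profiniteExponent.hom := by
  refine (injective_iff_map_eq_one profiniteExponent.hom).2 fun x hx =>
    Subtype.ext (funext fun N => ?_)
  let n := N.toSubgroup.index.factorization
  have hN : N.toSubgroup.index ≠ 0 := Subgroup.FiniteIndex.index_ne_zero
  let V (p : ℕ) [Fact p.Prime] : Set (Multiplicative ℤ_[p]) :=
    {y | y.toAdd ∈ Ideal.span {(p : ℤ_[p]) ^ n p}}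
  have hV (p : ℕ) [Fact p.Prime] : IsOpen (V p) := by
    -- Norms take discrete values, so the closed ball is also an open one, with exponent shifted by
    -- one.
    have h : V p = {y | ‖y.toAdd‖ < (p : ℝ) ^ (-(n p : ℤ) + 1)} := by
      ext y
      exact (PadicInt.norm_le_pow_iff_mem_span_pow _ _).symm.trans
        (PadicInt.norm_le_pow_iff_norm_lt_pow_add_one _ _)
    rw [h]
    exact isOpen_lt (continuous_norm.comp continuous_toAdd) continuous_const
  let U : Set (completion (GrpCat.of BaumslagGroup)) :=
    {y | y.1 N = x.1 N} ∩ ⋂ p ∈ {p : Nat.Primes | (p : ℕ) ∣ N.toSubgroup.index},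
      {y | profiniteExponent.hom y p ∈ V p}
  have hU : IsOpen U := by
    refine IsOpen.inter ?_ (Set.Finite.isOpen_biInter ?_ fun p _ => ?_)
    · have hc : Continuous fun y : completion (GrpCat.of BaumslagGroup) => y.1 N :=
        (continuous_apply N).comp continuous_subtype_val
      have : DiscreteTopology ((diagram (GrpCat.of BaumslagGroup)).obj N) := ⟨rfl⟩
      exact (isOpen_discrete {x.1 N}).preimage hc
    · exact (Set.finite_le_nat N.toSubgroup.index).preimage Subtype.val_injective.injOn |>.subset
        fun p hp => Nat.le_of_dvd (Nat.pos_of_ne_zero hN) hp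
    · exact (hV p).preimage ((continuous_apply p).comp profiniteExponent.hom.continuous_toFun)
  have hxU : x ∈ U := by
    refine ⟨rfl, Set.mem_iInter₂.2 fun p _ => ?_⟩
    rw [Set.mem_ofPred_eq, hx]
    exact zero_mem (Ideal.span {((p : ℕ) : ℤ_[p]) ^ n p})
  obtain ⟨g, hg⟩ := (denseRange (GrpCat.of BaumslagGroup)).exists_mem_open hU ⟨x, hxU⟩
  rw [← hg.1]
  refine (QuotientGroup.eq_one_iff g).2 (mem_of_index_dvd _ ?_)
  rw [Int.natCast_dvd]
  refine (Nat.dvd_iff_prime_pow_dvd_dvd _ _).2 fun p k hp hk => ?_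
  have : Fact p.Prime := ⟨hp⟩
  -- For k = 0 the prime p need not divide the index, and U says nothing about p.
  rcases Nat.eq_zero_or_pos k with rfl | hk0
  · simp
  have hpg := Set.mem_iInter₂.1 hg.2 ⟨p, hp⟩ ((dvd_pow_self p hk0.ne').trans hk)
  rw [Set.mem_ofPred_eq, profiniteExponent_etaFn] at hpg
  have hkn : k ≤ n p := (hp.pow_dvd_iff_le_factorization hN).1 hk
  refine (pow_dvd_pow p hkn).trans ?_
  rw [← Int.natCast_dvd]
  have h₁ := (PadicInt.norm_le_pow_iff_mem_span_pow _ _).2 hpg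
  exact_mod_cast PadicInt.norm_int_le_pow_iff_dvd.1 h₁

/-- The profinite completion of Baumslag's group is the product of the groups of `p`-adic
integers. -/
noncomputable def profiniteEquiv :
    completion (GrpCat.of BaumslagGroup) ≃ₜ* ∀ p : Nat.Primes, Multiplicative ℤ_[p] where
  toMulEquiv := MulEquiv.ofBijective profiniteExponent.hom.toMonoidHom
    ⟨profiniteExponent_injective, profiniteExponent_surjective⟩
  continuous_toFun := profiniteExponent.hom.continuous_toFun
  continuous_invFun := (profiniteExponent.hom.continuous_toFun.homeoOfEquivCompactToT2
    (f := Equiv.ofBijective profiniteExponent.hom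
      ⟨profiniteExponent_injective, profiniteExponent_surjective⟩)).symm.continuous

theorem diagonal_injective : Function.Injective diagonal := fun k l h => by
  let p : Nat.Primes := ⟨2, Nat.prime_two⟩
  have h' : (k.toAdd : ℤ_[p]) = l.toAdd := congrArg Multiplicative.toAdd (congrFun h p)
  exact Multiplicative.toAdd.injective (Int.cast_injective h')

theorem ker_eta :
    (eta (GrpCat.of BaumslagGroup)).hom.ker = commutator BaumslagGroup := by
  rw [← ker_exponent_eq_commutator]
  ext g
  have h : (eta (GrpCat.of BaumslagGroup)).hom g = 1 ↔ diagonal (exponent g) = 1 := by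
    rw [← profiniteExponent_etaFn]
    exact (map_eq_one_iff profiniteExponent.hom profiniteExponent_injective).symm
  exact h.trans (map_eq_one_iff diagonal diagonal_injective)

end BaumslagGroup

theorem mainTheorem6 :
    (TrueProsolubleCompletion.of BaumslagGroup).ker = (⨅ n : ℕ, derivedSeries BaumslagGroup n) ∧
    (⨅ n : ℕ, derivedSeries BaumslagGroup n) = commutator BaumslagGroup ∧
    (ProfiniteGrp.ProfiniteCompletion.eta (GrpCat.of BaumslagGroup)).hom.ker =
      commutator BaumslagGroup ∧
    commutator BaumslagGroup = Subgroup.normalClosure {BaumslagGroup.a} ∧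
    Group.IsPerfect (commutator BaumslagGroup) ∧
    commutator BaumslagGroup ≠ ⊥ ∧
    Nonempty (BaumslagGroup ⧸ commutator BaumslagGroup ≃* Multiplicative ℤ) ∧
    Nonempty (TrueProsolubleCompletion BaumslagGroup ≃ₜ* Multiplicative ℤ) ∧
    Nonempty (ProfiniteGrp.ProfiniteCompletion.completion (GrpCat.of BaumslagGroup) ≃ₜ*
      (∀ p : Nat.Primes, Multiplicative ℤ_[p])) ∧
    IsEmpty (TrueProsolubleCompletion BaumslagGroup ≃*
      ProfiniteGrp.ProfiniteCompletion.completion (GrpCat.of BaumslagGroup)) := by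
  refine ⟨BaumslagGroup.ker_of_eq_commutator.trans BaumslagGroup.iInf_derivedSeries.symm,
    BaumslagGroup.iInf_derivedSeries, BaumslagGroup.ker_eta,
    BaumslagGroup.commutator_eq_normalClosure, BaumslagGroup.isPerfect_commutator,
    BaumslagGroup.commutator_ne_bot, ⟨BaumslagGroup.quotientCommutatorEquiv⟩,
    ⟨BaumslagGroup.prosolubleEquiv⟩, ⟨BaumslagGroup.profiniteEquiv⟩, ⟨fun e => ?_⟩⟩
  have e' := (BaumslagGroup.prosolubleEquiv.toMulEquiv.symm.trans e).trans
    BaumslagGroup.profiniteEquiv.toMulEquiv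
  exact BaumslagGroup.not_isCyclic_padicProd
    (isCyclic_of_surjective e'.toMonoidHom e'.surjective)
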